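/- Let $p$ be a prime. For a finite group $G$ let $\mathrm{Sub}_G$ be the poset of its subgroups, and let $\mathrm{PreSh}_{\mathbb Q}(\mathrm{Sub}_G)$ be the abelian category of rational presheaves on it, i.e. contravariant functors from $\mathrm{Sub}_G$ to $\mathbb Q$-modules (equivalently, modules over the rational incidence algebra of $\mathrm{Sub}_G$). The global dimension of an abelian category is the largest natural number $n$ such that the bifunctor $\mathrm{Ext}^n$ is non-zero, or infinity if there is no largest such $n$. For $H\in\mathrm{Sub}_G$ let $S_H$ be the simple presheaf supported at $H$, where it takes the value $\mathbb Q$. (1) Let $k\ge 0$ and $G\cong (C_p)^{\times k}$. Then the global dimension of $\mathrm{PreSh}_{\mathbb Q}(\mathrm{Sub}_G)$ is $k$, and it is realised by the interval $I(G,e)$ between the trivial subgroup $e$ and $G$; that is, $k$ is the largest $n$ such that $\mathrm{Ext}^n(S_G,S_e)\neq 0$. (2) Let $G$ be a finite abelian $p$-group. Then $G$ is a direct product of non-trivial cyclic groups of prime-power order, and for every such decomposition, with $n$ factors, the global dimension of $\mathrm{PreSh}_{\mathbb Q}(\mathrm{Sub}_G)$ is $n$. In other words, it is the number of prime-power cyclic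 factors of $G$. -/

import Mathlib

open CategoryTheory

universe u v

/-- The bifunctor `Ext^n` of an abelian category is non-zero on the pair `(X, Y)`. (The vanishing
of an `Ext` group does not depend on the universe in which it is formed.) -/
def ExtNonzero {C : Type u} [Category.{v} C] [Abelian C] (n : ℕ) (X Y : C) : Prop :=
  letI := HasExt.standard C
  Nontrivial (Abelian.Ext.{max u v} X Y n)

/-- The global dimension of an abelian category: the largest natural number `n` such that the
bifunctor `Ext^n` is non-zero, and `⊤` if there is no largest one. (Only a category all of whose
objects are zero has the value `⊥`.) -/
noncomputable def globalDimension (C : Type u) [Category.{v} C] [Abelian C] : WithBot ℕ∞ :=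
  ⨆ (n : ℕ) (_ : ∃ X Y : C, ExtNonzero n X Y), ((n : ℕ∞) : WithBot ℕ∞)

/-- Rational presheaves on a poset `P`: contravariant functors from `P` to `ℚ`-modules. -/
abbrev RatPresheaf (P : Type u) [PartialOrder P] : Type _ :=
  Pᵒᵖ ⥤ ModuleCat.{v} ℚ

open Classical in
/-- The simple presheaf `S_x`, supported at `x`, where it takes the value `ℚ`: its value at `y` is
the space of maps from the proposition `y = x` to `ℚ`, that is, a copy of `ℚ` if `y = x` and `0`
otherwise. The restriction maps are the identity from `x` to `x` and zero in all other cases. -/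
noncomputable def simplePresheaf {P : Type u} [PartialOrder P] (x : P) : RatPresheaf.{u, v} P where
  obj y := ModuleCat.of ℚ (PLift (y.unop = x) → ULift.{v} ℚ)
  map {y z} _ := ModuleCat.ofHom
    { toFun := fun f _ => if h : y.unop = x then f ⟨h⟩ else 0
      map_add' := fun f g => by
        funext i
        by_cases h : y.unop = x <;> simp [h]
      map_smul' := fun c f => by
        funext i
        by_cases h : y.unop = x <;> simp [h] }
  map_id y := by
    refine ModuleCat.hom_ext (LinearMap.ext fun f => funext fun i => ?_)
    exact dif_pos i.down
  map_comp {y z t} a b := by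
    refine ModuleCat.hom_ext (LinearMap.ext fun f => funext fun i => ?_)
    by_cases h : y.unop = x
    · have hz : z.unop = x :=
        le_antisymm (h ▸ leOfHom a.unop) (i.down ▸ leOfHom b.unop)
      simp [h, hz]
    · simp [h]

/-- The group `G` is a direct product of `n` non-trivial cyclic groups of prime-power order, i.e.
`n` is the number of prime-power cyclic factors of `G`. -/
def HasPrimePowerCyclicFactors (G : Type u) [Group G] (n : ℕ) : Prop :=
  ∃ q a : Fin n → ℕ, (∀ i, (q i).Prime ∧ 0 < a i) ∧
    Nonempty (G ≃* ((i : Fin n) → Multiplicative (ZMod (q i ^ a i))))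

/-!
Write `V_A` (`constOn A`) for the presheaf that is `V` on an order-convex set `A` of subgroups and
`0` elsewhere. The simple presheaf at `x` is `V_{x}` for `V = ℚ`, the presheaf `V_(Iic x)` is
projective, and a lower set `D` contained in a lower set `C` gives a short exact sequence
`0 → V_D → V_C → V_(C \ D) → 0`.

For the upper bound, resolve `V_{x}` by `0 → V_(Iio x) → V_(Iic x) → V_{x} → 0`. The lower set
`Iio x` is generated by the maximal subgroups of `x`, and these are added one at a time; as the subgroup
lattice of an abelian group is modular, the intersections that occur are again generated by maximal
subgroups of a smaller group. Since all of them contain the subgroup `x ^ p` of `p`-th powers, this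
stops after as many steps as the rank of `x / x ^ p`
(`hasProjectiveDimensionLT_lowerClosure_coatoms`). Filtering an arbitrary presheaf by its support
(`hasProjectiveDimensionLT_of_singleton`) bounds the global dimension by the maximum of these ranks,
which is the rank of the `p`-torsion of `G`, that is, the number of cyclic factors.

For the lower bound, let `K` be elementary abelian of rank `r + 1`, `A` a maximal subgroup of `K`
and `l` a complement of `A`. The maximal subgroups of `K` that contain `l` generate a lower set with
no `Ext` to the simple presheaf at the trivial subgroup. Adding `A` to it adjoins the single element
`A`, so that a class in `Ext^r` of the simple presheaf at `A` gives one on the larger lower set. It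
survives when the remaining maximal subgroups are added, by the bounds on projective dimensions, and
its image in `Ext^(r + 1)` of the simple presheaf at `K` is non-zero
(`nontrivial_ext_singleton_bot`).
-/

universe w

/-! ### Presheaves that are constant on order-convex sets -/

/-- Short exactness of a complex of presheaves can be checked objectwise. -/
theorem CategoryTheory.ShortComplex.shortExact_of_app {J : Type*} [Category J] {R : Type*} [Ring R]
    (S : ShortComplex (J ⥤ ModuleCat.{v} R))
    (hf : ∀ j, Function.Injective (S.f.app j).hom)
    (hfg : ∀ j, Function.Exact (S.f.app j).hom (S.g.app j).hom)
    (hg : ∀ j, Function.Surjective (S.g.app j).hom) : S.ShortExact where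
  mono_f := by
    have : ∀ j, Mono (S.f.app j) := fun j => (ModuleCat.mono_iff_injective _).2 (hf j)
    exact NatTrans.mono_of_mono_app _
  epi_g := by
    have : ∀ j, Epi (S.g.app j) := fun j => (ModuleCat.epi_iff_surjective _).2 (hg j)
    exact NatTrans.epi_of_epi_app _
  exact := by
    rw [ShortComplex.exact_iff_isZero_homology]
    refine Functor.isZero _ fun j => ?_
    have h : (S.map ((evaluation J (ModuleCat.{v} R)).obj j)).Exact :=
      (ShortComplex.ShortExact.moduleCat_exact_iff_function_exact _).2 (hfg j)
    rw [ShortComplex.exact_iff_isZero_homology] at h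
    exact h.of_iso (S.mapHomologyIso ((evaluation J (ModuleCat.{v} R)).obj j)).symm

section
variable {P : Type u} [PartialOrder P]

open Classical in
/-- The linear map from `V`-valued functions on (the proofs of) a proposition `p` to those on a
proposition `q`: it is the identity of `V` if both hold, and zero otherwise. -/
noncomputable def truthMap (V : Type v) [AddCommGroup V] [Module ℚ V] (p q : Prop) :
    (PLift p → V) →ₗ[ℚ] (PLift q → V) where
  toFun f _ := if h : p then f ⟨h⟩ else 0
  map_add' f g := by
    funext i
    by_cases h : p <;> simp [h]
  map_smul' c f := by
    funext i
    by_cases h : p <;> simp [h]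

section truthMap
variable {V : Type v} [AddCommGroup V] [Module ℚ V] {p q r : Prop}

theorem truthMap_apply_of (h : p) (f : PLift p → V) (i : PLift q) :
    truthMap V p q f i = f ⟨h⟩ := dif_pos h

theorem truthMap_apply_of_not (h : ¬ p) (f : PLift p → V) (i : PLift q) :
    truthMap V p q f i = 0 := dif_neg h

theorem truthMap_truthMap (h : p → r → q) (f : PLift p → V) :
    truthMap V q r (truthMap V p q f) = truthMap V p r f := by
  funext i
  by_cases hp : p
  · rw [truthMap_apply_of (h hp i.down), truthMap_apply_of hp, truthMap_apply_of hp]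
  · rw [truthMap_apply_of_not hp]
    by_cases hq : q
    · rw [truthMap_apply_of hq, truthMap_apply_of_not hp]
    · rw [truthMap_apply_of_not hq]

theorem truthMap_truthMap_eq_zero (h : ¬ (p ∧ q ∧ r)) (f : PLift p → V) :
    truthMap V q r (truthMap V p q f) = 0 := by
  funext i
  by_cases hq : q
  · rw [truthMap_apply_of hq, truthMap_apply_of_not fun hp => h ⟨hp, hq, i.down⟩]
    rfl
  · rw [truthMap_apply_of_not hq]
    rfl

theorem truthMap_self (f : PLift p → V) : truthMap V p p f = f :=
  funext fun i => truthMap_apply_of i.down f i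

theorem truthMap_injective (h : p → q) : Function.Injective (truthMap V p q) := by
  intro f g hfg
  rw [← truthMap_self f, ← truthMap_self g, ← truthMap_truthMap fun hp _ => h hp, hfg,
    truthMap_truthMap fun hp _ => h hp]

theorem truthMap_surjective (h : q → p) : Function.Surjective (truthMap V p q) := fun f =>
  ⟨truthMap V q p f, by rw [truthMap_truthMap fun hq _ => h hq, truthMap_self]⟩

theorem truthMap_exact (hqr : q → (r ↔ ¬ p)) :
    Function.Exact (truthMap V p q) (truthMap V q r) := by
  intro f
  constructor
  · intro hf
    refine ⟨truthMap V q p f, funext fun i => ?_⟩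
    by_cases hp : p
    · rw [truthMap_apply_of hp, truthMap_apply_of i.down]
    · rw [truthMap_apply_of_not hp, ← truthMap_apply_of i.down f ⟨(hqr i.down).2 hp⟩, hf]
      rfl
  · rintro ⟨f, rfl⟩
    exact truthMap_truthMap_eq_zero (fun h => (hqr h.2.1).1 h.2.2 h.1) f

end truthMap

/-- The presheaf that takes the value `V` on the order-convex set `A` and `0` elsewhere, with the
identity of `V` as restriction map between any two elements of `A`. As for `simplePresheaf`, its
value at `y` is encoded as the space of maps from the proposition `y ∈ A` to `V`. -/
noncomputable def constOn (A : Set P) (hA : A.OrdConnected) (V : Type v) [AddCommGroup V]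
    [Module ℚ V] : RatPresheaf.{u, v} P where
  obj y := ModuleCat.of ℚ (PLift (y.unop ∈ A) → V)
  map {y z} _ := ModuleCat.ofHom (truthMap V (y.unop ∈ A) (z.unop ∈ A))
  map_id _ := ModuleCat.hom_ext (LinearMap.ext fun f => truthMap_self f)
  map_comp a b := ModuleCat.hom_ext (LinearMap.ext fun f => (truthMap_truthMap
    (fun hy ht => hA.out ht hy ⟨leOfHom b.unop, leOfHom a.unop⟩) f).symm)

theorem simplePresheaf_eq_constOn (x : P) :
    simplePresheaf.{u, v} x = constOn {x} Set.ordConnected_singleton (ULift.{v} ℚ) := rfl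

/-- The morphism between presheaves `constOn` that is the identity of `V` on `A ∩ B` and zero
elsewhere. -/
noncomputable def constOnMap {A B : Set P} (hA : A.OrdConnected) (hB : B.OrdConnected)
    (V : Type v) [AddCommGroup V] [Module ℚ V]
    (h : ∀ y z, z ≤ y → y ∈ A → z ∈ B → (z ∈ A ↔ y ∈ B)) :
    constOn A hA V ⟶ constOn B hB V where
  app y := ModuleCat.ofHom (truthMap V (y.unop ∈ A) (y.unop ∈ B))
  naturality y z a := by
    refine ModuleCat.hom_ext (LinearMap.ext fun (f : PLift (y.unop ∈ A) → V) => ?_)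
    change truthMap V (z.unop ∈ A) (z.unop ∈ B) (truthMap V (y.unop ∈ A) (z.unop ∈ A) f) =
      truthMap V (y.unop ∈ B) (z.unop ∈ B) (truthMap V (y.unop ∈ A) (y.unop ∈ B) f)
    have hzy := leOfHom a.unop
    by_cases hyz : y.unop ∈ A ∧ z.unop ∈ B
    · have := h _ _ hzy hyz.1 hyz.2
      by_cases hz : z.unop ∈ A
      · rw [truthMap_truthMap fun _ _ => hz, truthMap_truthMap fun _ _ => this.1 hz]
      · rw [truthMap_truthMap_eq_zero fun h => hz h.2.1,
          truthMap_truthMap_eq_zero fun h => hz (this.2 h.2.1)]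
    · rw [truthMap_truthMap_eq_zero fun h => hyz ⟨h.1, h.2.2⟩,
        truthMap_truthMap_eq_zero fun h => hyz ⟨h.1, h.2.2⟩]

/-- If the order-convex set `C` is split into a part `D` and a part `E` no element of which lies
below an element of `D`, then `constOn D` is a subpresheaf of `constOn C` with quotient `constOn E`.
-/
theorem exists_shortExact_constOn {C D E : Set P} (hC : C.OrdConnected) (hD : D.OrdConnected)
    (hE : E.OrdConnected) (V : Type v) [AddCommGroup V] [Module ℚ V]
    (hCDE : C = D ∪ E) (hDE : Disjoint D E) (hlow : ∀ d ∈ D, ∀ e ∈ E, ¬ e ≤ d) :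
    ∃ (f : constOn D hD V ⟶ constOn C hC V) (g : constOn C hC V ⟶ constOn E hE V)
      (w : f ≫ g = 0), (ShortComplex.mk f g w).ShortExact := by
  have hDE' : ∀ x, x ∈ D → x ∈ E → False := fun x h h' => Set.disjoint_left.1 hDE h h'
  subst hCDE
  refine ⟨constOnMap hD hC V ?_, constOnMap hC hE V ?_, ?_, ?_⟩
  · exact fun y z hzy hy hz =>
      ⟨fun _ => Or.inl hy, fun _ => hz.resolve_right fun h => hlow _ hy _ h hzy⟩
  · exact fun y z hzy hy hz =>
      ⟨fun _ => hy.resolve_left fun h => hlow _ h _ hz hzy, fun _ => Or.inr hz⟩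
  · ext y f
    exact truthMap_truthMap_eq_zero (fun h => hDE' _ h.1 h.2.2) f
  · exact ShortComplex.shortExact_of_app _
      (fun y => truthMap_injective Or.inl)
      (fun y => truthMap_exact fun hy =>
        ⟨fun h h' => hDE' _ h' h, fun h => hy.resolve_left h⟩)
      (fun y => truthMap_surjective Or.inr)

section principal
variable (x : P) (V : Type v) [AddCommGroup V] [Module ℚ V]

/-- Together with `exists_constOn_Iic_hom`, this is the adjunction between `V ↦ constOn (Iic x) V`
and evaluation at `x`: a morphism out of `constOn (Iic x) V` is determined by its component at `x`.
-/
theorem constOn_Iic_hom_ext {Y : RatPresheaf.{u, v} P}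
    {f g : constOn (Set.Iic x) Set.ordConnected_Iic V ⟶ Y}
    (h : f.app (Opposite.op x) = g.app (Opposite.op x)) : f = g := by
  ext y a
  by_cases hy : y.unop ∈ Set.Iic x
  · let φ : Opposite.op x ⟶ y := (homOfLE hy).op
    have hs : a = ((constOn (Set.Iic x) Set.ordConnected_Iic V).map φ).hom (fun _ => a ⟨hy⟩) :=
      
      funext fun i => (truthMap_apply_of (Set.self_mem_Iic (a := x)) (fun _ => a ⟨hy⟩) i).symm
    rw [hs]
    have e1 := congrArg (fun k => k.hom (fun _ => a ⟨hy⟩)) (f.naturality φ)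
    have e2 := congrArg (fun k => k.hom (fun _ => a ⟨hy⟩)) (g.naturality φ)
    rw [h] at e1
    exact e1.trans e2.symm
  · have : a = 0 := funext fun i => (hy i.down).elim
    rw [this, map_zero, map_zero]

open Classical in
/-- Every linear map from `V` to the value of `Y` at `x` extends to a morphism out of
`constOn (Iic x) V`. -/
theorem exists_constOn_Iic_hom {Y : RatPresheaf.{u, v} P} (g : V →ₗ[ℚ] Y.obj (Opposite.op x)) :
    ∃ f : constOn (Set.Iic x) Set.ordConnected_Iic V ⟶ Y,
      ∀ a : PLift (x ∈ Set.Iic x) → V,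
        (f.app (Opposite.op x)).hom a = g (a ⟨le_refl x⟩) := by
  let F (y : Pᵒᵖ) : (PLift (y.unop ∈ Set.Iic x) → V) →ₗ[ℚ] Y.obj y :=
    if h : y.unop ∈ Set.Iic x then
      (Y.map (homOfLE h).op : Y.obj (Opposite.op x) ⟶ Y.obj y).hom ∘ₗ g ∘ₗ LinearMap.proj ⟨h⟩
    else 0
  have hF (y : Pᵒᵖ) (h : y.unop ∈ Set.Iic x) (a) :
      F y a = (Y.map (homOfLE h).op : Y.obj (Opposite.op x) ⟶ Y.obj y).hom (g (a ⟨h⟩)) := by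
    simp only [F, dif_pos h]
    rfl
  refine ⟨{ app := fun y => ModuleCat.ofHom (F y), naturality := fun y z φ => ?_ }, fun a => ?_⟩
  · refine ModuleCat.hom_ext (LinearMap.ext fun (a : PLift (y.unop ∈ Set.Iic x) → V) => ?_)
    change F z (truthMap V _ _ a) = (Y.map φ).hom (F y a)
    by_cases hy : y.unop ∈ Set.Iic x
    · rw [hF y hy, hF z (Set.mem_Iic.2 ((leOfHom φ.unop).trans hy)), truthMap_apply_of hy]
      have : (homOfLE ((leOfHom φ.unop).trans hy)).op = (homOfLE hy).op ≫ φ := rfl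
      rw [this, Y.map_comp]
      rfl
    · have : a = 0 := funext fun i => (hy i.down).elim
      rw [this, map_zero, map_zero, map_zero, map_zero]
  · refine (hF (Opposite.op x) le_rfl a).trans ?_
    have : (homOfLE (le_refl x)).op = 𝟙 (Opposite.op x) := rfl
    change (Y.map (homOfLE (le_refl x)).op).hom _ = _
    rw [this, Y.map_id]
    rfl

/-- `V ↦ constOn (Iic x) V` is left adjoint to the exact functor of evaluation at `x`, and all
`ℚ`-modules `V` are projective. -/
instance projective_constOn_Iic :
    Projective (constOn (Set.Iic x) Set.ordConnected_Iic V : RatPresheaf.{u, v} P) where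
  factors {Y Z} f e he := by
    have he' : Function.Surjective (e.app (Opposite.op x)).hom :=
      (ModuleCat.epi_iff_surjective _).1 ((NatTrans.epi_iff_epi_app e).1 he _)
    let f' : V →ₗ[ℚ] Z.obj (Opposite.op x) :=
      (f.app (Opposite.op x)).hom ∘ₗ (LinearMap.pi fun _ => LinearMap.id)
    obtain ⟨g, hg⟩ := Module.projective_lifting_property _ f' he'
    obtain ⟨k, hk⟩ := exists_constOn_Iic_hom x V g
    refine ⟨k, constOn_Iic_hom_ext x V ?_⟩
    refine ModuleCat.hom_ext (LinearMap.ext fun (a : PLift (x ∈ Set.Iic x) → V) => ?_)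
    have := LinearMap.congr_fun hg (a ⟨le_refl x⟩)
    refine (congrArg (e.app (Opposite.op x)).hom (hk a)).trans (this.trans ?_)
    rfl

end principal
end

/-! ### Projective dimension of simple presheaves over modular lattices -/

section
variable {P : Type u} [PartialOrder P]

/-- The presheaf with constant value `V` on a lower set `D`, and `0` elsewhere: a subpresheaf of the
constant presheaf. -/
noncomputable abbrev lowerConst (D : LowerSet P) (V : Type v) [AddCommGroup V] [Module ℚ V] :
    RatPresheaf.{u, v} P :=
  constOn (D : Set P) D.lower.ordConnected V

theorem LowerSet.ordConnected_Iic_diff (D : LowerSet P) (a : P) :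
    (Set.Iic a \ (D : Set P)).OrdConnected :=
  ⟨fun _ hx _ hy _ hz => ⟨hz.2.trans hy.1, fun h => hx.2 (D.lower hz.1 h)⟩⟩

section
variable (D : LowerSet P) (a : P) (V : Type v) [AddCommGroup V] [Module ℚ V]

/-- This sequence and `exists_shortExact_inf_Iic` have the same quotient; together they replace the
Mayer-Vietoris sequence of the lower sets `D` and `Iic a`. -/
theorem exists_shortExact_sup_Iic :
    ∃ (f : lowerConst D V ⟶ lowerConst (D ⊔ LowerSet.Iic a) V)
      (g : lowerConst (D ⊔ LowerSet.Iic a) V ⟶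
        constOn (Set.Iic a \ (D : Set P)) (D.ordConnected_Iic_diff a) V)
      (w : f ≫ g = 0), (ShortComplex.mk f g w).ShortExact :=
  exists_shortExact_constOn _ _ _ V (by simp) Set.disjoint_sdiff_right
    fun _ hd _ he h => he.2 (D.lower h hd)

theorem exists_shortExact_inf_Iic :
    ∃ (f : lowerConst (D ⊓ LowerSet.Iic a) V ⟶ lowerConst (LowerSet.Iic a) V)
      (g : lowerConst (LowerSet.Iic a) V ⟶
        constOn (Set.Iic a \ (D : Set P)) (D.ordConnected_Iic_diff a) V)
      (w : f ≫ g = 0), (ShortComplex.mk f g w).ShortExact :=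
  exists_shortExact_constOn _ _ _ V
    (by ext y; by_cases h : y ∈ D <;> simp [h])
    (Set.disjoint_left.2 fun _ h h' => h'.2 h.1)
    fun _ hd _ he h => he.2 (D.lower h hd.1)

theorem exists_shortExact_singleton (x : P) (D : LowerSet P) (hD : (D : Set P) = Set.Iio x) :
    ∃ (f : lowerConst D V ⟶ lowerConst (LowerSet.Iic x) V)
      (g : lowerConst (LowerSet.Iic x) V ⟶ constOn {x} Set.ordConnected_singleton V)
      (w : f ≫ g = 0), (ShortComplex.mk f g w).ShortExact :=
  exists_shortExact_constOn _ _ _ V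
    (by rw [hD, Set.union_singleton, Set.Iio_insert, LowerSet.coe_Iic])
    (by simp [hD])
    (by
      rintro d hd _ rfl h
      rw [hD] at hd
      exact hd.not_ge h)

instance : Projective (lowerConst (LowerSet.Iic a) V : RatPresheaf.{u, v} P) :=
  projective_constOn_Iic a V

variable {D a V} in
theorem hasProjectiveDimensionLT_Iic_diff {n : ℕ}
    (h : HasProjectiveDimensionLT (lowerConst (D ⊓ LowerSet.Iic a) V) n) :
    HasProjectiveDimensionLT (constOn (Set.Iic a \ (D : Set P)) (D.ordConnected_Iic_diff a) V)
      (n + 1) := by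
  obtain ⟨f, g, w, hS⟩ := exists_shortExact_inf_Iic D a V
  exact hS.hasProjectiveDimensionLT_X₃ n h
    (hasProjectiveDimensionLT_of_ge (lowerConst (LowerSet.Iic a) V) 1 _ (by lia))

end

theorem isZero_lowerConst_lowerClosure_empty (V : Type v) [AddCommGroup V] [Module ℚ V] :
    Limits.IsZero (lowerConst (lowerClosure (∅ : Set P)) V : RatPresheaf.{u, v} P) := by
  refine Functor.isZero _ fun y => ?_
  have : IsEmpty (PLift (y.unop ∈ ((lowerClosure (∅ : Set P) : LowerSet P) : Set P))) :=
    ⟨fun h => by simpa using h.down⟩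
  exact ModuleCat.isZero_of_iff_subsingleton.2
    (inferInstanceAs (Subsingleton (PLift (y.unop ∈ _) → V)))

theorem lowerClosure_coatoms [Finite P] (x : P) :
    (lowerClosure {a | a ⋖ x} : Set P) = Set.Iio x := by
  ext y
  simp only [SetLike.mem_coe, mem_lowerClosure, Set.mem_ofPred_eq, Set.mem_Iio]
  constructor
  · rintro ⟨a, ha, hy⟩
    exact hy.trans_lt ha.lt
  · intro h
    obtain ⟨a, h1, h2⟩ := exists_le_covBy_of_lt h
    exact ⟨a, h2, h1⟩

end

section
variable {P : Type u} [Lattice P]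

theorem lowerClosure_insert_eq (S : Set P) (a : P) :
    lowerClosure (insert a S) = lowerClosure S ⊔ LowerSet.Iic a := by
  ext y
  simp [or_comm]

theorem lowerClosure_inf_Iic (S : Set P) (a : P) :
    lowerClosure S ⊓ LowerSet.Iic a = lowerClosure ((a ⊓ ·) '' S) := by
  ext y
  simp [mem_lowerClosure]
  grind

theorem CovBy.inf_covBy_left [IsLowerModularLattice P] {x a b : P} (ha : a ⋖ x) (hb : b ⋖ x)
    (hab : a ≠ b) : a ⊓ b ⋖ a :=
  CovBy.inf_of_sup_right (by rwa [ha.wcovBy.sup_eq hb.wcovBy hab])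

section
variable [IsLowerModularLattice P] {ρ : P → ℕ} (hρ : StrictMono ρ)
  (V : Type v) [AddCommGroup V] [Module ℚ V]
include hρ

/-- The upper bound. Let `ρ` be strictly monotone. In a lower modular lattice, the lower set
generated by elements that are covered by `x` and lie above `f` has projective dimension less than
`ρ x - ρ f`. When a generator `a` is added, the intersection of `Iic a` with the lower set of the
other generators `s` is generated by the elements `a ⊓ s`, which are covered by `a` and lie above
`f`, so that induction on the rank of `x` applies. -/
theorem hasProjectiveDimensionLT_lowerClosure_coatoms {n : ℕ} {x f : P} {S : Set P}
    (hfin : S.Finite) (hS : ∀ s ∈ S, f ≤ s ∧ s ⋖ x) (hn : ρ x ≤ ρ f + n) :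
    HasProjectiveDimensionLT (lowerConst (lowerClosure S) V) n := by
  induction n using Nat.strong_induction_on generalizing x S with
  | _ n ih =>
  induction S, hfin using Set.Finite.induction_on with
  | empty =>
    have := (isZero_lowerConst_lowerClosure_empty (P := P) V).hasProjectiveDimensionLT_zero
    exact hasProjectiveDimensionLT_of_ge _ 0 _ (by lia)
  | @insert a S ha hfin ih' =>
    have hax := hS a (Set.mem_insert _ _)
    have h1 := hρ.monotone hax.1
    have h2 := hρ hax.2.lt
    -- The existence of `a` forces `n` to be positive, as `ρ f ≤ ρ a < ρ x`.
    obtain ⟨m, rfl⟩ : ∃ m, n = m + 1 := ⟨n - 1, by lia⟩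
    have hE := hasProjectiveDimensionLT_Iic_diff (D := lowerClosure S) (a := a) (V := V)
      (n := m) (by
      rw [lowerClosure_inf_Iic]
      refine ih m (by lia) (x := a) (hfin.image _) ?_ (by lia)
      rintro _ ⟨s, hs, rfl⟩
      have hsx := hS s (Set.mem_insert_of_mem _ hs)
      exact ⟨le_inf hax.1 hsx.1, hax.2.inf_covBy_left hsx.2 fun h => ha (h ▸ hs)⟩)
    obtain ⟨f, g, w, hSE⟩ := exists_shortExact_sup_Iic (lowerClosure S) a V
    rw [lowerClosure_insert_eq]
    exact hSE.hasProjectiveDimensionLT_X₂ _ (ih' fun s hs => hS s (Set.mem_insert_of_mem _ hs)) hE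

theorem hasProjectiveDimensionLT_singleton [Finite P] {n : ℕ} {x f : P}
    (hf : ∀ a, a ⋖ x → f ≤ a) (hn : ρ x ≤ ρ f + n) :
    HasProjectiveDimensionLT
      (constOn {x} Set.ordConnected_singleton V : RatPresheaf.{u, v} P) (n + 1) := by
  obtain ⟨f', g, w, hS⟩ := exists_shortExact_singleton V x _ (lowerClosure_coatoms x)
  exact hS.hasProjectiveDimensionLT_X₃ n
    (hasProjectiveDimensionLT_lowerClosure_coatoms hρ V (Set.toFinite _)
      (fun a ha => ⟨hf a ha, ha⟩) hn)
    (hasProjectiveDimensionLT_of_ge (lowerConst (LowerSet.Iic x) V) 1 _ (by lia))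
end
end

section
variable {P : Type u} [PartialOrder P]

/-- If `x` is maximal in the support of `X`, then the value of `X` at `x` is a quotient of `X`. -/
theorem exists_hom_constOn_singleton (X : RatPresheaf.{u, v} P) (x : P)
    (hX : ∀ y, x < y → Subsingleton (X.obj (Opposite.op y))) :
    ∃ g : X ⟶ constOn {x} Set.ordConnected_singleton (X.obj (Opposite.op x)),
      Epi g ∧ Function.Injective (g.app (Opposite.op x)).hom := by
  let F (y : Pᵒᵖ) : X.obj y →ₗ[ℚ] (PLift (y.unop ∈ ({x} : Set P)) → X.obj (Opposite.op x)) :=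
    LinearMap.pi fun i =>
      (X.map (homOfLE (le_of_eq (Set.eq_of_mem_singleton i.down).symm)).op :
        X.obj y ⟶ X.obj (Opposite.op x)).hom
  have hFx (a i) : F (Opposite.op x) a i = a := by
    change (X.map (𝟙 (Opposite.op x))).hom a = a
    rw [X.map_id]
    rfl
  refine ⟨{ app := fun y => ModuleCat.ofHom (F y), naturality := fun y z φ => ?_ }, ?_, ?_⟩
  · refine ModuleCat.hom_ext (LinearMap.ext fun a => funext fun i => ?_)
    change F z ((X.map φ).hom a) i =
      truthMap _ (y.unop ∈ ({x} : Set P)) (z.unop ∈ ({x} : Set P)) (F y a) i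
    have hz : z.unop = x := i.down
    by_cases hy : y.unop ∈ ({x} : Set P)
    · rw [truthMap_apply_of hy]
      change (X.map φ ≫ X.map _).hom a = _
      rw [← X.map_comp]
      rfl
    · have : Subsingleton (X.obj y) :=
        hX y.unop (lt_of_le_of_ne (hz ▸ leOfHom φ.unop) fun h => hy h.symm)
      rw [Subsingleton.elim a 0, map_zero, map_zero, map_zero, map_zero]
  · rw [NatTrans.epi_iff_epi_app]
    intro y
    rw [ModuleCat.epi_iff_surjective]
    intro b
    by_cases hy : y.unop = x
    · obtain rfl : y = Opposite.op x := by rw [← hy]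
      exact ⟨b ⟨rfl⟩, funext fun i => hFx _ i⟩
    · exact ⟨0, funext fun i => (hy i.down).elim⟩
  · intro a b hab
    have := congrFun hab ⟨rfl⟩
    exact (hFx a _).symm.trans (this.trans (hFx b _))

/-- Over a finite poset, every presheaf is an iterated extension of presheaves supported at a single
element, so these control the projective dimension. Induction on the support: split off the value
at a maximal element. -/
theorem hasProjectiveDimensionLT_of_singleton [Finite P] {n : ℕ}
    (h : ∀ (x : P) (V : Type v) [AddCommGroup V] [Module ℚ V], HasProjectiveDimensionLT
      (constOn {x} Set.ordConnected_singleton V : RatPresheaf.{u, v} P) n)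
    (X : RatPresheaf.{u, v} P) : HasProjectiveDimensionLT X n := by
  suffices H : ∀ (T : Set P) (_ : T.Finite) (X : RatPresheaf.{u, v} P),
      (∀ y, y ∉ T → Subsingleton (X.obj (Opposite.op y))) → HasProjectiveDimensionLT X n from
    H Set.univ Set.finite_univ X fun y hy => (hy trivial).elim
  intro T hT
  induction hc : T.ncard generalizing T with
  | zero =>
    intro X hX
    rw [Set.ncard_eq_zero hT] at hc
    have : HasProjectiveDimensionLT X 0 :=
      Limits.IsZero.hasProjectiveDimensionLT_zero (Functor.isZero _ fun y =>
        ModuleCat.isZero_of_iff_subsingleton.2 (hX y.unop (by simp [hc])))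
    exact hasProjectiveDimensionLT_of_ge _ 0 _ (by lia)
  | succ k ih =>
    intro X hX
    obtain ⟨x, hx⟩ := hT.exists_maximal (Set.nonempty_of_ncard_ne_zero (by lia))
    obtain ⟨g, hg, hgx⟩ := exists_hom_constOn_singleton X x
      fun y hy => hX y fun hyT => hx.not_prop_of_gt hy hyT
    have hS : (ShortComplex.mk (Limits.kernel.ι g) g (Limits.kernel.condition g)).ShortExact :=
      { exact := ShortComplex.exact_kernel g }
    refine hS.hasProjectiveDimensionLT_X₂ n ?_ (h x _)
    refine ih (T \ {x}) (hT.subset Set.sdiff_subset) ?_ _ fun y hy => ?_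
    · rw [Set.ncard_sdiff_singleton_of_mem hx.prop, hc]
      rfl
    · have hι : Function.Injective ((Limits.kernel.ι g).app (Opposite.op y)).hom :=
        (ModuleCat.mono_iff_injective _).1 ((NatTrans.mono_iff_mono_app _).1 inferInstance _)
      by_cases hyT : y ∈ T
      · obtain rfl : y = x := by_contra fun hyx => hy ⟨hyT, hyx⟩
        refine ⟨fun a b => hι (hgx ?_)⟩
        have h0 : ∀ a, (g.app (Opposite.op y)).hom
            (((Limits.kernel.ι g).app (Opposite.op y)).hom a) = 0 := fun a => by
          have := congrArg (fun k => (k.app (Opposite.op y)).hom a) (Limits.kernel.condition g)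
          exact this
        exact (h0 a).trans (h0 b).symm
      · have := hX y hyT
        exact hι.subsingleton

end

/-! ### Non-vanishing of `Ext` in complemented modular lattices -/

namespace CategoryTheory.ShortComplex.ShortExact
open Abelian
variable {C : Type u} [Category.{v} C] [Abelian C] [HasExt.{w} C] {S : ShortComplex C}
  (hS : S.ShortExact) {Y : C} {n : ℕ}
include hS

theorem subsingleton_ext_X₁ (h₂ : Subsingleton (Ext S.X₂ Y n))
    (h₃ : Subsingleton (Ext S.X₃ Y (n + 1))) : Subsingleton (Ext S.X₁ Y n) := by
  refine subsingleton_of_forall_eq 0 fun x => ?_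
  obtain ⟨y, rfl⟩ := Ext.contravariant_sequence_exact₁ hS Y x (add_comm 1 n)
    (Subsingleton.elim _ _)
  rw [Subsingleton.elim y 0, Ext.comp_zero]

theorem subsingleton_ext_X₂ (h₁ : Subsingleton (Ext S.X₁ Y n))
    (h₃ : Subsingleton (Ext S.X₃ Y n)) : Subsingleton (Ext S.X₂ Y n) := by
  refine subsingleton_of_forall_eq 0 fun x => ?_
  obtain ⟨y, rfl⟩ := Ext.contravariant_sequence_exact₂ hS Y x (Subsingleton.elim _ _)
  rw [Subsingleton.elim y 0, Ext.comp_zero]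

theorem subsingleton_ext_X₃ (h₁ : ∀ m, m + 1 = n → Subsingleton (Ext S.X₁ Y m))
    (h₂ : Subsingleton (Ext S.X₂ Y n)) : Subsingleton (Ext S.X₃ Y n) := by
  cases n with
  | zero =>
    have := hS.epi_g
    exact (Ext.precomp_mk₀_injective_of_epi Y S.g).subsingleton
  | succ m =>
    have := h₁ m rfl
    refine subsingleton_of_forall_eq 0 fun x => ?_
    obtain ⟨y, rfl⟩ := Ext.contravariant_sequence_exact₃ hS Y x (Subsingleton.elim _ _)
      (add_comm 1 m)
    rw [Subsingleton.elim y 0, Ext.comp_zero]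

end CategoryTheory.ShortComplex.ShortExact

section
open Abelian

theorem nontrivial_ext_zero_singleton {P : Type u} [PartialOrder P]
    [HasExt.{w} (RatPresheaf.{u, v} P)] (V : Type v) [AddCommGroup V] [Module ℚ V] [Nontrivial V]
    (x : P) :
    Nontrivial (Ext (constOn {x} Set.ordConnected_singleton V : RatPresheaf.{u, v} P)
      (constOn {x} Set.ordConnected_singleton V) 0) := by
  obtain ⟨a, ha⟩ := exists_ne (0 : V)
  refine @Equiv.nontrivial _ _ Ext.homEquiv₀ ⟨𝟙 _, 0, fun h => ha ?_⟩
  have := congrArg (fun k => (k.app (Opposite.op x)).hom (fun _ => a)) h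
  exact congrFun this ⟨rfl⟩

variable {P : Type u} [PartialOrder P] [OrderBot P] [HasExt.{w} (RatPresheaf.{u, v} P)]
  (V : Type v) [AddCommGroup V] [Module ℚ V]

theorem subsingleton_ext_Iic {a : P} (ha : a ≠ ⊥) (n : ℕ) :
    Subsingleton (Ext (lowerConst (LowerSet.Iic a) V)
      (constOn {(⊥ : P)} Set.ordConnected_singleton V) n) := by
  cases n with
  | zero =>
    refine @Equiv.subsingleton _ _ Ext.homEquiv₀ ⟨fun f g => constOn_Iic_hom_ext a V ?_⟩
    refine ModuleCat.hom_ext (LinearMap.ext fun x => funext fun i => (ha i.down).elim)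
  | succ n => exact HasProjectiveDimensionLT.subsingleton _ 1 _ (by lia) _

end

section
open Abelian
variable {P : Type u} [Lattice P] [OrderBot P] [HasExt.{w} (RatPresheaf.{u, v} P)]
  (V : Type v) [AddCommGroup V] [Module ℚ V]

/-- A lower set generated by elements above some `l ≠ ⊥` has no `Ext` to the simple presheaf at `⊥`:
such a presheaf is resolved by the projectives `constOn (Iic a)` with `l ≤ a`, and these have no
non-zero morphisms to it. -/
theorem subsingleton_ext_lowerClosure {l : P} (hl : l ≠ ⊥) {S : Set P} (hfin : S.Finite)
    (hS : ∀ s ∈ S, l ≤ s) (n : ℕ) :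
    Subsingleton (Ext (lowerConst (lowerClosure S) V)
      (constOn {(⊥ : P)} Set.ordConnected_singleton V) n) := by
  induction hc : S.ncard using Nat.strong_induction_on generalizing n S with
  | _ c ih =>
  obtain rfl | ⟨a, ha⟩ := S.eq_empty_or_nonempty
  · have hz : Limits.IsZero (lowerConst (lowerClosure (∅ : Set P)) V : RatPresheaf.{u, v} P) :=
      isZero_lowerConst_lowerClosure_empty V
    have := hz.hasProjectiveDimensionLT_zero
    exact HasProjectiveDimensionLT.subsingleton _ 0 _ (by lia) _
  · have hfin' : (S \ {a}).Finite := hfin.subset Set.sdiff_subset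
    have hlt : (S \ {a}).ncard < c := hc ▸ Set.ncard_sdiff_singleton_lt_of_mem ha hfin
    have hD (n : ℕ) := ih _ hlt hfin' (fun s hs => hS s hs.1) n rfl
    have hDa (n : ℕ) := ih _ ((Set.ncard_image_le (f := (a ⊓ ·)) hfin').trans_lt hlt)
      (hfin'.image _)
      (by
        rintro _ ⟨s, hs, rfl⟩
        exact le_inf (hS a ha) (hS s hs.1)) n rfl
    rw [← Set.insert_sdiff_self_of_mem ha, lowerClosure_insert_eq]
    obtain ⟨f, g, w, hS₁⟩ := exists_shortExact_sup_Iic (lowerClosure (S \ {a})) a V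
    obtain ⟨f', g', w', hS₂⟩ := exists_shortExact_inf_Iic (lowerClosure (S \ {a})) a V
    have haz : a ≠ ⊥ := fun h => hl (le_bot_iff.1 (h ▸ hS a ha))
    refine hS₁.subsingleton_ext_X₂ (hD n)
      (hS₂.subsingleton_ext_X₃ (fun m _ => ?_) (subsingleton_ext_Iic V haz n))
    dsimp only
    rw [lowerClosure_inf_Iic]
    exact hDa m

variable [IsModularLattice P] {ρ : P → ℕ} (hρ : StrictMono ρ)
include hρ

/-- Adding an element covered by `K` to a generating set of such elements does not kill `Ext^r` to
the simple presheaf at `⊥`, since by the bound on projective dimensions the restriction map on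
`Ext^r` is surjective. -/
theorem nontrivial_ext_lowerClosure_insert {r : ℕ} {K a : P} {S : Set P} (hfin : S.Finite)
    (hS : ∀ s ∈ S, s ⋖ K) (ha : a ⋖ K) (har : ρ a ≤ ρ ⊥ + r)
    (h : Nontrivial (Ext (lowerConst (lowerClosure S) V)
      (constOn {(⊥ : P)} Set.ordConnected_singleton V) r)) :
    Nontrivial (Ext (lowerConst (lowerClosure (insert a S)) V)
      (constOn {(⊥ : P)} Set.ordConnected_singleton V) r) := by
  by_cases haS : a ∈ S
  · rwa [Set.insert_eq_of_mem haS]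
  by_contra hcon
  rw [not_nontrivial_iff_subsingleton, lowerClosure_insert_eq] at hcon
  rw [← not_subsingleton_iff_nontrivial] at h
  obtain ⟨f, g, w, hS₁⟩ := exists_shortExact_sup_Iic (lowerClosure S) a V
  refine h (hS₁.subsingleton_ext_X₁ hcon ?_)
  have hE := hasProjectiveDimensionLT_Iic_diff (D := lowerClosure S) (a := a) (V := V) (n := r) (by
    rw [lowerClosure_inf_Iic]
    refine hasProjectiveDimensionLT_lowerClosure_coatoms hρ V (hfin.image _) (x := a) ?_ har
    rintro _ ⟨s, hs, rfl⟩
    exact ⟨bot_le, ha.inf_covBy_left (hS s hs) fun h => haS (h ▸ hs)⟩)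
  exact hE.subsingleton _ _ _ le_rfl _

theorem nontrivial_ext_lowerClosure_of_subset {r : ℕ} {K : P} {S T : Set P} (hfin : T.Finite)
    (hST : S ⊆ T) (hT : ∀ s ∈ T, s ⋖ K ∧ ρ s ≤ ρ ⊥ + r)
    (h : Nontrivial (Ext (lowerConst (lowerClosure S) V)
      (constOn {(⊥ : P)} Set.ordConnected_singleton V) r)) :
    Nontrivial (Ext (lowerConst (lowerClosure T) V)
      (constOn {(⊥ : P)} Set.ordConnected_singleton V) r) := by
  suffices H : ∀ U : Set P, U.Finite → U ⊆ T →
      Nontrivial (Ext (lowerConst (lowerClosure (U ∪ S)) V)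
        (constOn {(⊥ : P)} Set.ordConnected_singleton V) r) by
    have := H T hfin subset_rfl
    rwa [Set.union_eq_left.2 hST] at this
  intro U hU
  induction U, hU using Set.Finite.induction_on with
  | empty => intro _; rwa [Set.empty_union]
  | @insert a U _ hU ih =>
    intro hUT
    have haT := hT a (hUT (Set.mem_insert _ _))
    have hUT' := (Set.subset_insert a U).trans hUT
    rw [Set.insert_union]
    exact nontrivial_ext_lowerClosure_insert V hρ (hU.union (hfin.subset hST))
      (fun s hs => (hT s (hs.elim (@hUT' s) (@hST s))).1) haT.1 haT.2 (ih hUT')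

/-- The lower bound. In a modular lattice graded by `ρ`, if every element covered by some `b ≤ K`
has a complement in the interval below `b`, then `Ext^(ρ K)` from the simple presheaf at `K` to the
one at `⊥` is non-zero. For the induction, choose `A` covered by `K` and a complement `l` of `A`.
The lower set generated by the elements covered by `K` and lying above `l` contains all elements
below `A` except `A` itself, so that adding `A` as a generator gives an extension of the simple
presheaf at `A` by a presheaf with no `Ext` to the simple presheaf at `⊥`. -/
theorem nontrivial_ext_singleton_bot [Finite P] [Nontrivial V] {r : ℕ} {K : P}
    (hcov : ∀ a b, a ⋖ b → ρ b = ρ a + 1) (hbot : ρ ⊥ = 0)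
    (hK : ∀ b ≤ K, ∀ a, a ⋖ b → ∃ l, a ⊓ l = ⊥ ∧ a ⊔ l = b) (hr : ρ K = r) :
    Nontrivial (Ext (constOn {K} Set.ordConnected_singleton V)
      (constOn {(⊥ : P)} Set.ordConnected_singleton V) r) := by
  induction r generalizing K with
  | zero =>
    have : K = ⊥ := by
      by_contra hne
      have := hρ (bot_lt_iff_ne_bot.2 hne)
      lia
    subst this
    exact nontrivial_ext_zero_singleton V _
  | succ r ih =>
    have hKbot : K ≠ ⊥ := by
      rintro rfl
      lia
    obtain ⟨A, -, hA⟩ := exists_le_covBy_of_lt (bot_lt_iff_ne_bot.2 hKbot)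
    obtain ⟨l, hAl, hAlK⟩ := hK K le_rfl A hA
    have hl : l ≠ ⊥ := by
      rintro rfl
      rw [sup_bot_eq] at hAlK
      exact hA.ne hAlK
    have hAr : ρ A = r := by have := hcov A K hA; lia
    have hExtA := ih (K := A) (fun b hb => hK b (hb.trans hA.le)) hAr
    -- `T₀` generates a lower set that meets `Iic A` in `Iio A`.
    let T₀ : Set P := {a | a ⋖ K ∧ l ≤ a}
    have hAT : ∀ y, y ≤ A → (y ∈ lowerClosure T₀ ↔ y ≠ A) := by
      intro y hy
      rw [mem_lowerClosure]
      constructor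
      · rintro ⟨a, ⟨haK, hla⟩, hya⟩ rfl
        exact haK.lt.not_ge (hAlK ▸ sup_le hya hla)
      · intro hne
        have hlt : y ⊔ l < K := by
          refine lt_of_le_of_ne (hAlK ▸ sup_le_sup_right hy l) fun h => hne ?_
          have := sup_inf_assoc_of_le l hy
          rwa [inf_comm l, hAl, sup_bot_eq, h, inf_eq_right.2 hA.le, eq_comm] at this
        obtain ⟨a, h1, h2⟩ := exists_le_covBy_of_lt hlt
        exact ⟨a, ⟨h2, le_sup_right.trans h1⟩, le_sup_left.trans h1⟩
    obtain ⟨f, g, w, hS₁⟩ := exists_shortExact_constOn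
      (lowerClosure (insert A T₀)).lower.ordConnected
      (lowerClosure T₀).lower.ordConnected (Set.ordConnected_singleton (a := A)) V
      (by
        rw [lowerClosure_insert_eq]
        ext y
        have := hAT y
        simp only [LowerSet.coe_sup, LowerSet.coe_Iic, Set.mem_union, SetLike.mem_coe, Set.mem_Iic,
          Set.mem_singleton_iff]
        by_cases hy : y = A
        · simp [hy]
        · simp [hy] at this ⊢
          exact this)
      (by
        rw [Set.disjoint_singleton_right]
        exact fun h => (hAT A le_rfl).1 h rfl)
      (by
        rintro d hd _ rfl h
        exact (hAT _ le_rfl).1 ((lowerClosure T₀).lower h hd) rfl)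
    have hExt₁ : Nontrivial (Ext (lowerConst (lowerClosure (insert A T₀)) V)
        (constOn {(⊥ : P)} Set.ordConnected_singleton V) r) := by
      by_contra hcon
      rw [not_nontrivial_iff_subsingleton] at hcon
      rw [← not_subsingleton_iff_nontrivial] at hExtA
      exact hExtA (hS₁.subsingleton_ext_X₃
        (fun m _ => subsingleton_ext_lowerClosure V hl (Set.toFinite _) (fun s hs => hs.2) m) hcon)
    have hExt₂ := nontrivial_ext_lowerClosure_of_subset V hρ (r := r) (K := K)
      (Set.toFinite {a | a ⋖ K})
      (Set.insert_subset hA fun a ha => ha.1)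
      (fun s (hs : s ⋖ K) => ⟨hs, by have := hcov s K hs; lia⟩) hExt₁
    obtain ⟨f, g, w, hS₂⟩ := exists_shortExact_singleton V K _ (lowerClosure_coatoms K)
    by_contra hcon
    rw [not_nontrivial_iff_subsingleton] at hcon
    rw [← not_subsingleton_iff_nontrivial] at hExt₂
    exact hExt₂ (hS₂.subsingleton_ext_X₁ (subsingleton_ext_Iic V hKbot r) hcon)

end

/-! ### Subgroups of finite abelian `p`-groups -/

section
variable {C : Type u} [Category.{v} C] [Abelian C]

theorem ExtNonzero.le {n d : ℕ} {X Y : C} (h : ExtNonzero n X Y)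
    (hX : HasProjectiveDimensionLT X (d + 1)) : n ≤ d := by
  by_contra hlt
  let := HasExt.standard C
  exact not_subsingleton_iff_nontrivial.2 h (hX.subsingleton _ _ n (by lia) Y)

theorem globalDimension_eq {d : ℕ} (hle : ∀ X : C, HasProjectiveDimensionLT X (d + 1))
    {X Y : C} (h : ExtNonzero d X Y) : globalDimension C = ((d : ℕ∞) : WithBot ℕ∞) := by
  refine le_antisymm (iSup₂_le fun n hn => ?_) (le_iSup₂_of_le d ⟨X, Y, h⟩ le_rfl)
  obtain ⟨X, Y, hXY⟩ := hn
  exact_mod_cast hXY.le (hle X)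
end

section
variable {G : Type u} [CommGroup G] {p : ℕ}

theorem Subgroup.mem_of_zpow_mem_of_isCoprime {A : Subgroup G} {b : G} {m n : ℤ}
    (hmn : IsCoprime m n) (hm : b ^ m ∈ A) (hn : b ^ n ∈ A) : b ∈ A := by
  obtain ⟨s, t, hst⟩ := hmn
  have : b = (b ^ m) ^ s * (b ^ n) ^ t := by
    rw [← zpow_mul, ← zpow_mul, ← zpow_add, mul_comm m, mul_comm n, hst, zpow_one]
  rw [this]
  exact mul_mem (zpow_mem hm _) (zpow_mem hn _)

theorem Subgroup.sup_zpowers_eq_of_covBy {A B : Subgroup G} (h : A ⋖ B) {b : G} (hb : b ∈ B)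
    (hbA : b ∉ A) : A ⊔ zpowers b = B := by
  have h1 : A < A ⊔ zpowers b :=
    lt_of_le_of_ne le_sup_left fun h => hbA (h ▸ mem_sup_right (mem_zpowers b))
  exact (h.eq_or_eq h1.le (sup_le h.le (zpowers_le.2 hb))).resolve_left h1.ne'

/-- In an abelian `p`-group, a maximal subgroup `A` of `B` contains the `p`-th powers of `B`:
otherwise `B` is generated by `A` and `b ^ p`, which gives `b ^ (1 - p * j) ∈ A` for some `j`, where
`1 - p * j` is prime to the order of `b`. -/
theorem IsPGroup.pow_mem_of_covBy (hG : IsPGroup p G) {A B : Subgroup G} (h : A ⋖ B) {b : G}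
    (hb : b ∈ B) : b ^ p ∈ A := by
  by_contra hbp
  have hbB : b ∈ A ⊔ Subgroup.zpowers (b ^ p) := by
    rwa [Subgroup.sup_zpowers_eq_of_covBy h (pow_mem hb p) hbp]
  obtain ⟨a, ha, c, hc, hac⟩ := Subgroup.mem_sup.1 hbB
  obtain ⟨j, rfl⟩ := Subgroup.mem_zpowers_iff.1 hc
  obtain ⟨k, hk⟩ := hG b
  refine hbp (pow_mem (Subgroup.mem_of_zpow_mem_of_isCoprime
    (m := 1 - p * j) (n := (p : ℤ) ^ k) ?_ ?_ ?_) p)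
  · exact IsCoprime.pow_right ⟨1, j, by ring⟩
  · have : b ^ (1 - p * j : ℤ) = a := by
      rw [zpow_sub, zpow_one, zpow_mul, zpow_natCast, mul_inv_eq_iff_eq_mul, hac]
    rwa [this]
  · have : b ^ ((p : ℤ) ^ k) = 1 := by exact_mod_cast hk
    rw [this]
    exact one_mem A

variable [Fact p.Prime]

theorem Subgroup.exists_complement_of_covBy {A B : Subgroup G}
    (hB : B ≤ (powMonoidHom p : G →* G).ker) (h : A ⋖ B) :
    ∃ L : Subgroup G, A ⊓ L = ⊥ ∧ A ⊔ L = B := by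
  obtain ⟨b, hb, hbA⟩ := SetLike.exists_of_lt h.lt
  refine ⟨Subgroup.zpowers b, ?_, Subgroup.sup_zpowers_eq_of_covBy h hb hbA⟩
  have hbp : b ^ p = 1 := hB hb
  rw [eq_bot_iff]
  rintro _ ⟨hcA, j, rfl⟩
  by_cases hj : (p : ℤ) ∣ j
  · obtain ⟨i, rfl⟩ := hj
    simp [zpow_mul, hbp]
  · refine (hbA (Subgroup.mem_of_zpow_mem_of_isCoprime (m := p) (n := j) ?_ ?_ hcA)).elim
    · exact (Nat.prime_iff_prime_int.1 Fact.out).irreducible.coprime_iff_not_dvd.2 hj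
    · rw [zpow_natCast, hbp]
      exact one_mem A

namespace IsPGroup

variable [Finite G]

theorem card_subgroup_eq (hG : IsPGroup p G) (H : Subgroup G) :
    Nat.card H = p ^ (Nat.card H).factorization p := by
  obtain ⟨k, hk⟩ := IsPGroup.iff_card.1 (hG.to_subgroup H)
  rw [hk, Nat.Prime.factorization_pow Fact.out, Finsupp.single_eq_same]

theorem strictMono_factorization_card (hG : IsPGroup p G) :
    StrictMono fun H : Subgroup G => (Nat.card H).factorization p := by
  intro A B h
  have hlt : Nat.card A < Nat.card B := by
    by_contra hle
    exact h.ne (Subgroup.eq_of_le_of_card_ge h.le (not_lt.1 hle))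
  rw [hG.card_subgroup_eq A, hG.card_subgroup_eq B] at hlt
  exact (Nat.pow_lt_pow_iff_right (Fact.out : p.Prime).one_lt).1 hlt

theorem factorization_card_of_covBy (hG : IsPGroup p G) {A B : Subgroup G} (h : A ⋖ B) :
    (Nat.card B).factorization p = (Nat.card A).factorization p + 1 := by
  have hmono := hG.strictMono_factorization_card
  have hdvd : p ^ ((Nat.card A).factorization p + 1) ∣ Nat.card B := by
    rw [hG.card_subgroup_eq B]
    exact pow_dvd_pow p (hmono h.lt)
  have hA : Nat.card (A.subgroupOf B) = p ^ (Nat.card A).factorization p := by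
    rw [Nat.card_congr (Subgroup.subgroupOfEquivOfLe h.le).toEquiv, ← hG.card_subgroup_eq A]
  obtain ⟨K, hK, hAK⟩ := Sylow.exists_subgroup_card_pow_succ hdvd hA
  have hK' : Nat.card (K.map B.subtype) = p ^ ((Nat.card A).factorization p + 1) := by
    rw [← hK, Subgroup.card_subtype]
  have hAK' : A ≤ K.map B.subtype := by
    have := Subgroup.map_mono (f := B.subtype) hAK
    rwa [Subgroup.subgroupOf_map_subtype, inf_eq_left.2 h.le] at this
  have hne : K.map B.subtype ≠ A := by
    intro heq
    have := Nat.pow_right_injective (Fact.out : p.Prime).two_le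
      ((hG.card_subgroup_eq A).symm.trans (heq ▸ hK'))
    lia
  rw [← (h.eq_or_eq hAK' (Subgroup.map_subtype_le K)).resolve_left hne, hK',
    Nat.Prime.factorization_pow Fact.out, Finsupp.single_eq_same]

/-- The projective dimension of the simple presheaf at `B` is at most the rank of `B / B ^ p`, which
is the rank of the `p`-torsion of `B` and so at most that of the `p`-torsion of `G`. -/
theorem hasProjectiveDimensionLT_presheaf_subgroup (hG : IsPGroup p G) {n : ℕ}
    (hn : Nat.card (powMonoidHom p : G →* G).ker = p ^ n) (X : RatPresheaf.{u, v} (Subgroup G)) :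
    HasProjectiveDimensionLT X (n + 1) := by
  refine hasProjectiveDimensionLT_of_singleton (fun B V _ _ => ?_) X
  -- The image of `φ` is the subgroup of `p`-th powers of `B`.
  let φ : B →* G := (powMonoidHom p : G →* G).comp B.subtype
  refine hasProjectiveDimensionLT_singleton hG.strictMono_factorization_card V (f := φ.range) ?_ ?_
  · rintro A hA _ ⟨b, rfl⟩
    exact hG.pow_mem_of_covBy hA b.2
  · have h1 : Nat.card φ.ker * Nat.card φ.range = Nat.card B := by
      rw [← Subgroup.index_ker, Subgroup.card_mul_index]
    have h2 : Nat.card φ.ker ≤ p ^ n := by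
      rw [← hn]
      exact Nat.card_le_card_of_injective
        (fun x : φ.ker => (⟨(x : B), x.2⟩ : (powMonoidHom p : G →* G).ker))
        fun x y hxy => Subtype.ext (Subtype.ext
          (congrArg (fun z : (powMonoidHom p : G →* G).ker => (z : G)) hxy))
    have h3 := (Nat.mul_le_mul_right (Nat.card φ.range) h2)
    rw [h1, hG.card_subgroup_eq B, hG.card_subgroup_eq φ.range, ← pow_add] at h3
    have := (Nat.pow_le_pow_iff_right (Fact.out : p.Prime).one_lt).1 h3
    lia

/-- The global dimension is attained on the interval below the `p`-torsion subgroup, which is an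
elementary abelian group. -/
theorem extNonzero_ker_powMonoidHom_bot (hG : IsPGroup p G) {n : ℕ}
    (hn : Nat.card (powMonoidHom p : G →* G).ker = p ^ n) :
    ExtNonzero n (simplePresheaf.{u, v} (powMonoidHom p : G →* G).ker)
      (simplePresheaf.{u, v} (⊥ : Subgroup G)) := by
  let := HasExt.standard (RatPresheaf.{u, v} (Subgroup G))
  rw [simplePresheaf_eq_constOn, simplePresheaf_eq_constOn]
  refine nontrivial_ext_singleton_bot (ULift.{v} ℚ) hG.strictMono_factorization_card
    (fun A B h => hG.factorization_card_of_covBy h) (by simp)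
    (fun B hB A hA => Subgroup.exists_complement_of_covBy hB hA) ?_
  simp only [hn]
  rw [Nat.Prime.factorization_pow Fact.out, Finsupp.single_eq_same]

end IsPGroup

theorem card_multiplicative_zmod (m : ℕ) : Nat.card (Multiplicative (ZMod m)) = m :=
  (Nat.card_congr Multiplicative.toAdd).trans (Nat.card_zmod m)

theorem card_ker_powMonoidHom_of_mulEquiv_pi {n : ℕ} {m : Fin n → ℕ}
    (hm : ∀ i, ∃ k, 0 < k ∧ m i = p ^ k)
    (e : G ≃* ((i : Fin n) → Multiplicative (ZMod (m i)))) :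
    Nat.card (powMonoidHom p : G →* G).ker = p ^ n := by
  have hfac (i : Fin n) :
      Nat.card (powMonoidHom p : Multiplicative (ZMod (m i)) →* Multiplicative (ZMod (m i))).ker
        = p := by
    obtain ⟨k, hk, hmk⟩ := hm i
    have : NeZero (m i) := ⟨hmk ▸ pow_ne_zero k (Fact.out : p.Prime).ne_zero⟩
    rw [IsCyclic.card_powMonoidHom_ker, card_multiplicative_zmod, hmk]
    exact Nat.gcd_eq_right (dvd_pow_self p hk.ne')
  let E : (powMonoidHom p : G →* G).ker ≃ ((i : Fin n) →
      (powMonoidHom p : Multiplicative (ZMod (m i)) →* Multiplicative (ZMod (m i))).ker) :=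
    (e.toEquiv.subtypeEquiv (q := fun x => ∀ i, x i ∈
      (powMonoidHom p : Multiplicative (ZMod (m i)) →* Multiplicative (ZMod (m i))).ker)
      fun x => by
        simp only [MonoidHom.mem_ker, powMonoidHom_apply]
        rw [← e.map_eq_one_iff, map_pow, funext_iff]
        rfl).trans Equiv.subtypePiEquivPi
  rw [Nat.card_congr E, Nat.card_pi, Finset.prod_congr rfl fun i _ => hfac i]
  simp

theorem IsPGroup.exists_eq_pow_of_mulEquiv_pi (hG : IsPGroup p G) {ι : Type*} {m : ι → ℕ}
    (e : G ≃* ((i : ι) → Multiplicative (ZMod (m i)))) (i : ι) (hm : 1 < m i) :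
    ∃ k, 0 < k ∧ m i = p ^ k := by
  classical
  have : NeZero (m i) := ⟨by lia⟩
  have h := (hG.of_equiv e).of_injective
    (MonoidHom.mulSingle (fun i => Multiplicative (ZMod (m i))) i) 
    (Pi.mulSingle_injective (M := fun i => Multiplicative (ZMod (m i))) i)
  obtain ⟨k, hk⟩ := IsPGroup.iff_card.1 h
  rw [card_multiplicative_zmod] at hk
  refine ⟨k, Nat.pos_of_ne_zero ?_, hk⟩
  rintro rfl
  simp at hk
  lia

end

theorem lemma5p4 (p : ℕ) (hp : p.Prime) :
    -- elementary abelian groups `G ≅ (C_p)^k`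
    (∀ (k : ℕ) (G : Type u) [Group G],
      Nonempty (G ≃* (Fin k → Multiplicative (ZMod p))) →
        globalDimension (RatPresheaf.{u, v} (Subgroup G)) = ((k : ℕ∞) : WithBot ℕ∞) ∧
        IsGreatest {n : ℕ | ExtNonzero n
          (simplePresheaf.{u, v} (⊤ : Subgroup G)) (simplePresheaf.{u, v} (⊥ : Subgroup G))} k) ∧
    -- finite abelian `p`-groups
    (∀ (G : Type u) [CommGroup G] [Finite G], IsPGroup p G →
      (∃ n : ℕ, HasPrimePowerCyclicFactors G n) ∧
      ∀ n : ℕ, HasPrimePowerCyclicFactors G n →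
        globalDimension (RatPresheaf.{u, v} (Subgroup G)) = ((n : ℕ∞) : WithBot ℕ∞)) := by
  have : Fact p.Prime := ⟨hp⟩
  refine ⟨?_, fun G _ _ hG => ⟨?_, ?_⟩⟩
  · rintro k G hGrp ⟨e⟩
    let : CommGroup G :=
      { hGrp with mul_comm := fun a b => e.injective (by rw [map_mul, map_mul, mul_comm]) }
    have : Finite G := Finite.of_equiv _ e.symm.toEquiv
    have hcard : Nat.card G = p ^ k := by
      rw [Nat.card_congr e.toEquiv, Nat.card_fun, card_multiplicative_zmod,
        Nat.card_fin]
    have hG : IsPGroup p G := IsPGroup.of_card hcard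
    have hker := card_ker_powMonoidHom_of_mulEquiv_pi (fun _ => ⟨1, one_pos, (pow_one p).symm⟩) e
    have hpd := hG.hasProjectiveDimensionLT_presheaf_subgroup hker
    have hExt := hG.extNonzero_ker_powMonoidHom_bot hker
    rw [Subgroup.eq_top_of_card_eq _ (hker.trans hcard.symm)] at hExt
    exact ⟨globalDimension_eq hpd hExt, hExt, fun n hn => ExtNonzero.le hn (hpd _)⟩
  · obtain ⟨ι, _, m, hm, ⟨e⟩⟩ := CommGroup.equiv_prod_multiplicative_zmod_of_finite G
    choose a ha hma using fun i => hG.exists_eq_pow_of_mulEquiv_pi e i (hm i)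
    obtain rfl : m = fun i => p ^ a i := funext hma
    let σ := (Fintype.equivFin ι).symm
    exact ⟨Fintype.card ι, fun _ => p, a ∘ σ, fun i => ⟨hp, ha _⟩,
      ⟨e.trans 
        { (Equiv.piCongrLeft (fun i => Multiplicative (ZMod (p ^ a i))) σ).symm with
          map_mul' := fun _ _ => rfl }⟩⟩
  · rintro n ⟨q, a, hqa, ⟨e⟩⟩
    have hker := card_ker_powMonoidHom_of_mulEquiv_pi (fun i =>
      hG.exists_eq_pow_of_mulEquiv_pi e i (Nat.one_lt_pow (hqa i).2.ne' (hqa i).1.one_lt)) e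
    exact globalDimension_eq (hG.hasProjectiveDimensionLT_presheaf_subgroup hker)
      (hG.extNonzero_ker_powMonoidHom_bot hker)
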